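/- Let $\kappa$ be a Mahlo cardinal (strongly inaccessible, with the regular cardinals below $\kappa$ forming a stationary subset of $\kappa$) and let $\lambda\ge\kappa$ be a cardinal. Let $P_\kappa A$ be the set of subsets of $A$ of cardinality less than $\kappa$, and for $x\in P_\kappa\lambda$ put $\kappa_x=|x\cap\kappa|$. For $f:P_\kappa\lambda\to P_\kappa\lambda$ let $C_f=\{x\in P_\kappa\lambda : x\cap\kappa\neq\emptyset \text{ and } f[P_{\kappa_x}x]\subseteq P_{\kappa_x}x\}$. A set $S\subseteq P_\kappa\lambda$ is strongly stationary if $S\cap C_f\neq\emptyset$ for every such $f$; let ${\rm NSS}_{\kappa,\lambda}$ be the collection of subsets of $P_\kappa\lambda$ that are not strongly stationary. Let ${\rm NS}_{\kappa,\lambda}$ be the collection of $X\subseteq P_\kappa\lambda$ that are disjoint from some closed unbounded $C\subseteq P_\kappa\lambda$, that is, from some $C$ that is $\subseteq$-cofinal in $P_\kappa\lambda$ and closed under unions of nonempty $\subseteq$-chains of fewer than $\kappa$ members. For a cardinal $\mu$ and a set of ordinals $A$ let $V_0(\mu,A)=A$, $V_{\alpha+1}(\mu,A)=P_\mu(V_\alpha(\mu,A))\cup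 V_\alpha(\mu,A)$, and $V_\alpha(\mu,A)=\bigcup_{\beta<\alpha}V_\beta(\mu,A)$ for limit $\alpha$. A set $S\subseteq P_\kappa\lambda$ is $\Pi^1_0$-indescribable (first-order indescribable) if for every $R\subseteq V_\kappa(\kappa,\lambda)$ and every first-order sentence $\varphi$ with $(V_\kappa(\kappa,\lambda),\in,R)\models\varphi$ there is $x\in S$ such that $x\cap\kappa=\kappa_x$ and $(V_{\kappa_x}(\kappa_x,x),\in,R\cap V_{\kappa_x}(\kappa_x,x))\models\varphi$. Let $\Pi^1_0(\kappa,\lambda)$ be the collection of subsets of $P_\kappa\lambda$ that are not $\Pi^1_0$-indescribable. Then a set $S\subseteq P_\kappa\lambda$ is $\Pi^1_0$-indescribable if and only if it is strongly stationary; in other words, $$\Pi^1_0(\kappa,\lambda)={\rm NSS}_{\kappa,\lambda}.$$ Moreover, ${\rm NSS}_{\kappa,\lambda}\neq{\rm NS}_{\kappa,\lambda}$. -/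

import Mathlib

universe u

noncomputable section

namespace PKL

open Cardinal Ordinal FirstOrder

/-- A Mahlo cardinal: a strongly inaccessible cardinal `κ` such that every club subset of `κ`
contains a regular cardinal. -/
def IsMahlo (κ : Cardinal.{u}) : Prop :=
  κ.IsInaccessible ∧
    ∀ C : Set (Set.Iio κ.ord), IsClub C → ∃ a ∈ C, ∃ μ : Cardinal.{u}, μ.IsRegular ∧ a.1 = μ.ord

/-- `P_κ A`: the set of all subsets of `A` of cardinality less than `κ`. -/
def smallSubsets (κ : Cardinal.{u}) (A : ZFSet.{u}) : ZFSet.{u} :=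
  A.powerset.sep fun z => z.card < κ

theorem mem_smallSubsets {κ : Cardinal.{u}} {A z : ZFSet.{u}} :
    z ∈ smallSubsets κ A ↔ z ⊆ A ∧ z.card < κ := by
  simp [smallSubsets]

/-- `P_κ lam`, where the cardinal `lam` is viewed as a von Neumann ordinal. -/
def Pk (κ lam : Cardinal.{u}) : ZFSet.{u} := smallSubsets κ lam.ord.toZFSet

/-- `κ_x = |x ∩ κ|`. -/
def kap (κ : Cardinal.{u}) (x : ZFSet.{u}) : Cardinal.{u} := (x ∩ κ.ord.toZFSet).card

/-! ### Jech's nonstationary ideal -/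

/-- Closed unbounded subsets of `P_κ lam` in the sense of Jech: cofinal in `(P_κ lam, ⊆)`, and
closed under unions of nonempty `⊆`-chains of fewer than `κ` members. -/
structure IsJechClub (κ lam : Cardinal.{u}) (C : ZFSet.{u}) : Prop where
  subset : C ⊆ Pk κ lam
  unbounded : ∀ x ∈ Pk κ lam, ∃ y ∈ C, x ⊆ y
  closed : ∀ D : ZFSet.{u}, D ⊆ C → D ≠ ∅ → D.card < κ →
    (∀ x ∈ D, ∀ y ∈ D, x ⊆ y ∨ y ⊆ x) → ZFSet.sUnion D ∈ C

/-- `NS_{κ,lam}`: the collection of nonstationary subsets of `P_κ lam`. -/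
def NS (κ lam : Cardinal.{u}) : Set ZFSet.{u} :=
  {X | X ⊆ Pk κ lam ∧ ∃ C, IsJechClub κ lam C ∧ X ∩ C = ∅}

/-! ### Strong stationarity -/

/-- `C_f = {x ∈ P_κ lam : x ∩ κ ≠ ∅ and f[P_{κ_x} x] ⊆ P_{κ_x} x}`. -/
def weakClub (κ lam : Cardinal.{u}) (f : ZFSet.{u} → ZFSet.{u}) : ZFSet.{u} :=
  (Pk κ lam).sep fun x => x ∩ κ.ord.toZFSet ≠ ∅ ∧
    ∀ y ∈ smallSubsets (kap κ x) x, f y ∈ smallSubsets (kap κ x) x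

/-- `f` restricts to a function from `P_κ lam` to `P_κ lam`. -/
def MapsPk (κ lam : Cardinal.{u}) (f : ZFSet.{u} → ZFSet.{u}) : Prop :=
  ∀ x ∈ Pk κ lam, f x ∈ Pk κ lam

/-- `S` meets `C_f` for every `f : P_κ lam → P_κ lam`. -/
def StronglyStationary (κ lam : Cardinal.{u}) (S : ZFSet.{u}) : Prop :=
  ∀ f : ZFSet.{u} → ZFSet.{u}, MapsPk κ lam f → weakClub κ lam f ∩ S ≠ ∅

/-- `NSS_{κ,lam}`: the collection of subsets of `P_κ lam` that are disjoint from some `C_f`. -/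
def NSS (κ lam : Cardinal.{u}) : Set ZFSet.{u} :=
  {X | X ⊆ Pk κ lam ∧
    ∃ f : ZFSet.{u} → ZFSet.{u}, MapsPk κ lam f ∧ X ∩ weakClub κ lam f = ∅}

/-! ### The two-cardinal cumulative hierarchy -/

/-- `V_α(κ, A)`: `V_0(κ, A) = A`, `V_{α+1}(κ, A) = P_κ(V_α(κ, A)) ∪ V_α(κ, A)`, and unions at
limit stages. -/
def hier (κ : Cardinal.{u}) (A : ZFSet.{u}) (α : Ordinal.{u}) : ZFSet.{u} :=
  Ordinal.limitRecOn (motive := fun _ => ZFSet.{u}) α A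
    (fun _ V => smallSubsets κ V ∪ V)
    (fun γ _ V => ZFSet.iUnion fun β : Set.Iio γ => V β.1 β.2)

theorem hier_zero (κ : Cardinal.{u}) (A : ZFSet.{u}) : hier κ A 0 = A := by
  simp [hier]

theorem hier_add_one (κ : Cardinal.{u}) (A : ZFSet.{u}) (α : Ordinal.{u}) :
    hier κ A (α + 1) = smallSubsets κ (hier κ A α) ∪ hier κ A α := by
  simp [hier]

theorem hier_limit (κ : Cardinal.{u}) (A : ZFSet.{u}) {γ : Ordinal.{u}}
    (h : Order.IsSuccLimit γ) :
    hier κ A γ = ZFSet.iUnion fun β : Set.Iio γ => hier κ A β.1 := by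
  simp [hier, h]

/-- `V_κ(κ, A)`. -/
def hierTop (κ : Cardinal.{u}) (A : ZFSet.{u}) : ZFSet.{u} := hier κ A κ.ord

/-! ### First-order indescribability -/

/-- The relation symbols: a binary symbol for membership and a unary predicate symbol. -/
inductive SetPredRel : ℕ → Type
  | mem : SetPredRel 2
  | pred : SetPredRel 1

/-- The first-order language of the structures `(M, ∈, R)`. -/
def setPredLang : FirstOrder.Language := ⟨fun _ => Empty, SetPredRel⟩

/-- The structure `(M, ∈, R)`. -/
@[reducible]
def setPredStructure (M R : ZFSet.{u}) : setPredLang.Structure M where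
  funMap := fun g => g.elim
  RelMap := fun r => match r with
    | SetPredRel.mem => fun v => (v 0).1 ∈ (v 1).1
    | SetPredRel.pred => fun v => (v 0).1 ∈ R

/-- `(M, ∈, R) ⊨ φ`. -/
def Models (M R : ZFSet.{u}) (φ : setPredLang.Sentence) : Prop :=
  @FirstOrder.Language.Sentence.Realize setPredLang M (setPredStructure M R) φ

/-- `S` is `Π¹₀`-indescribable, that is, first-order indescribable: every first-order sentence
true in `(V_κ(κ, lam), ∈, R)` is true in `(V_{κ_x}(κ_x, x), ∈, R ∩ V_{κ_x}(κ_x, x))` for some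
`x ∈ S` with `x ∩ κ = κ_x`. -/
def FirstOrderIndescribable (κ lam : Cardinal.{u}) (S : ZFSet.{u}) : Prop :=
  ∀ R : ZFSet.{u}, R ⊆ hierTop κ lam.ord.toZFSet → ∀ φ : setPredLang.Sentence,
    Models (hierTop κ lam.ord.toZFSet) R φ →
      ∃ x ∈ S, x ∩ κ.ord.toZFSet = (kap κ x).ord.toZFSet ∧
        Models (hierTop (kap κ x) x) (R ∩ hierTop (kap κ x) x) φ

/-- `Π¹₀(κ, lam)`: the collection of subsets of `P_κ lam` that are not `Π¹₀`-indescribable. -/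
def Pi10 (κ lam : Cardinal.{u}) : Set ZFSet.{u} :=
  {X | X ⊆ Pk κ lam ∧ ¬ FirstOrderIndescribable κ lam X}

end PKL

end

namespace PKL

open Cardinal Ordinal FirstOrder

/-! From strong stationarity to indescribability, `f` is a Skolem function: `f y` collects supports
of witnesses for all formulas with parameters in V_{|y|}(|y|, y), fewer than κ tuples because κ is
inaccessible. Adding `reflectBase` makes κ_x a regular limit cardinal at closure points x, so every
element of V_{κ_x}(κ_x, x) has a support in P_{κ_x} x (`exists_support`), and Tarski–Vaught yields
an elementary substructure.

Conversely, `f` is coded by a set of Kuratowski pairs, and `pairSentence` says that every y is a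
first coordinate. Reflecting it to x puts `f y` into V_{κ_x}(κ_x, x) for y in P_{κ_x} x, hence into
P_{κ_x} x.

The ideals differ because closure points of `reflectBase` have κ_x regular, while every club
contains the union x of an ω-chain of rapidly growing sets: were κ_x regular, x would have size
below κ_x = |x ∩ κ|. -/

theorem card_iUnion_lt {ι : Type (u + 1)} [Small.{u} ι] {c : Cardinal.{u}} (hc : c.IsRegular)
    (hι : #ι < Cardinal.lift.{u + 1} c) {f : ι → ZFSet.{u}} (hf : ∀ i, (f i).card < c) :
    (ZFSet.iUnion f).card < c := by
  have hU : ZFSet.iUnion f = ZFSet.iUnion (f ∘ (equivShrink.{u} ι).symm) := by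
    ext z
    simp [(equivShrink.{u} ι).symm.surjective.exists]
  have hι' : #(Shrink.{u} ι) < c := by
    rw [← Cardinal.lift_lt.{u, u + 1}]
    have := Cardinal.mk_congr_lift (equivShrink.{u} ι)
    rw [Cardinal.lift_id'.{u, u + 1}] at this
    exact this ▸ hι
  rw [hU]
  have := ZFSet.lift_card_iUnion_le_sum_card (f := f ∘ (equivShrink.{u} ι).symm)
  rw [Cardinal.lift_id] at this
  exact this.trans_lt (Cardinal.sum_lt_of_isRegular hc hι' fun i => hf _)

theorem mk_coe_lt {x : ZFSet.{u}} {c : Cardinal.{u}} :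
    #x < Cardinal.lift.{u + 1} c ↔ x.card < c := by
  rw [ZFSet.cardinalMk_coe_sort, Cardinal.lift_lt]

theorem card_sUnion_lt {c : Cardinal.{u}} (hc : c.IsRegular) {x : ZFSet.{u}} (hx : x.card < c)
    (h : ∀ y ∈ x, y.card < c) : (ZFSet.sUnion x).card < c := by
  refine (ZFSet.card_mono ?_).trans_lt
    (card_iUnion_lt hc (mk_coe_lt.2 hx) (f := fun y : x => y.1) fun y => h y.1 y.2)
  intro z hz
  obtain ⟨y, hy, hzy⟩ := ZFSet.mem_sUnion.1 hz
  exact ZFSet.mem_iUnion.2 ⟨⟨y, hy⟩, hzy⟩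

theorem card_union_lt {c : Cardinal.{u}} (hc : ℵ₀ ≤ c) {x y : ZFSet.{u}} (hx : x.card < c)
    (hy : y.card < c) : (x ∪ y).card < c :=
  ZFSet.card_union_le.trans_lt (Cardinal.add_lt_of_lt hc hx hy)

theorem exists_subset_card_eq {A : ZFSet.{u}} {c : Cardinal.{u}} (h : c ≤ A.card) :
    ∃ t ⊆ A, t.card = c := by
  have h' : Cardinal.lift.{u + 1} c ≤ #(A : Set ZFSet.{u}) := by
    have := ZFSet.cardinalMk_coe_sort (x := A)
    change #(A : Set ZFSet.{u}) = _ at this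
    rwa [this, Cardinal.lift_le]
  obtain ⟨S, hS, hSc⟩ := Cardinal.le_mk_iff_exists_subset.1 h'
  have hcoe : ((A.sep (· ∈ S) : ZFSet.{u}) : Set ZFSet.{u}) = S := by
    ext z
    simpa using fun hz => hS hz
  refine ⟨A.sep (· ∈ S), ZFSet.sep_subset, Cardinal.lift_injective.{u + 1} ?_⟩
  rw [← ZFSet.cardinalMk_coe_sort, ← hSc]
  change #((A.sep (· ∈ S) : ZFSet.{u}) : Set ZFSet.{u}) = _
  rw [hcoe]

/-! ### The hierarchy -/

theorem smallSubsets_mono {μ ν : Cardinal.{u}} {A B : ZFSet.{u}} (hμ : μ ≤ ν) (hA : A ⊆ B) :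
    smallSubsets μ A ⊆ smallSubsets ν B := fun _ hz =>
  mem_smallSubsets.2 ⟨fun _ h => hA ((mem_smallSubsets.1 hz).1 h),
    (mem_smallSubsets.1 hz).2.trans_le hμ⟩

/-- Removes the zero/successor/limit split, so that later arguments run by well-founded induction on
the level. -/
theorem mem_hier_iff {μ : Cardinal.{u}} {A y : ZFSet.{u}} {α : Ordinal.{u}} :
    y ∈ hier μ A α ↔ y ∈ A ∨ ∃ β < α, y ⊆ hier μ A β ∧ y.card < μ := by
  induction α using Ordinal.limitRecOn with
  | zero => simp [hier_zero]
  | add_one α ih =>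
    rw [hier_add_one, ZFSet.mem_union, mem_smallSubsets, ih]
    constructor
    · rintro (h | h | ⟨β, hβ, h⟩)
      · exact .inr ⟨α, lt_add_one α, h⟩
      · exact .inl h
      · exact .inr ⟨β, hβ.trans (lt_add_one α), h⟩
    · rintro (h | ⟨β, hβ, h⟩)
      · exact .inr (.inl h)
      · rcases (Order.lt_add_one_iff.1 hβ).eq_or_lt with rfl | hβ
        · exact .inl h
        · exact .inr (.inr ⟨β, hβ, h⟩)
  | limit γ hγ ih =>
    rw [hier_limit μ A hγ, ZFSet.mem_iUnion]
    constructor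
    · rintro ⟨⟨δ, hδ⟩, h⟩
      rcases (ih δ hδ).1 h with h | ⟨β, hβ, h⟩
      · exact .inl h
      · exact .inr ⟨β, hβ.trans hδ, h⟩
    · rintro (h | ⟨β, hβ, h⟩)
      · exact ⟨⟨0, hγ.bot_lt⟩, by simpa [hier_zero] using h⟩
      · exact ⟨⟨β + 1, hγ.add_one_lt hβ⟩, (ih _ (hγ.add_one_lt hβ)).2
          (.inr ⟨β, lt_add_one β, h⟩)⟩

theorem hier_mono {μ ν : Cardinal.{u}} {A B : ZFSet.{u}} {α β : Ordinal.{u}} (hμ : μ ≤ ν)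
    (hA : A ⊆ B) (hα : α ≤ β) : hier μ A α ⊆ hier ν B β := by
  induction α using WellFoundedLT.induction generalizing β with
  | _ α ih =>
    intro y hy
    rcases mem_hier_iff.1 hy with h | ⟨γ, hγ, h, hc⟩
    · exact mem_hier_iff.2 (.inl (hA h))
    · exact mem_hier_iff.2 (.inr ⟨γ, hγ.trans_le hα, fun z hz => ih γ hγ le_rfl (h hz),
        hc.trans_le hμ⟩)

theorem hierTop_mono {μ ν : Cardinal.{u}} {A B : ZFSet.{u}} (hμ : μ ≤ ν) (hA : A ⊆ B) :
    hierTop μ A ⊆ hierTop ν B :=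
  hier_mono hμ hA (Cardinal.ord_le_ord.2 hμ)

theorem subset_hierTop {μ : Cardinal.{u}} {A : ZFSet.{u}} : A ⊆ hierTop μ A := fun _ h =>
  mem_hier_iff.2 (.inl h)

theorem card_hier_lt {κ μ : Cardinal.{u}} (hκ : κ.IsInaccessible) {A : ZFSet.{u}}
    (hA : A.card < κ) {α : Ordinal.{u}} (hα : α < κ.ord) : (hier μ A α).card < κ := by
  induction α using WellFoundedLT.induction with
  | _ α ih =>
    have hsub : hier μ A α ⊆
        A ∪ ZFSet.iUnion fun β : Set.Iio α => (hier μ A β.1).powerset := by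
      intro y hy
      rcases mem_hier_iff.1 hy with h | ⟨β, hβ, h, -⟩
      · exact ZFSet.mem_union.2 (.inl h)
      · exact ZFSet.mem_union.2 (.inr (ZFSet.mem_iUnion.2 ⟨⟨β, hβ⟩, ZFSet.mem_powerset.2 h⟩))
    refine (ZFSet.card_mono hsub).trans_lt (card_union_lt hκ.aleph0_lt.le hA ?_)
    refine card_iUnion_lt hκ.isRegular ?_ fun β => ?_
    · rw [Cardinal.mk_Iio_ordinal, Cardinal.lift_lt]
      exact Cardinal.lt_ord.1 hα
    · rw [ZFSet.card_powerset]
      exact hκ.isStrongPrelimit (ih β.1 β.2 (lt_trans β.2 hα))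

/-- Supports localise elements of the hierarchy. The lemma is applied both to (κ, lam) and to (κ_x,
x), hence the hypothesis that μ is only a regular limit. -/
theorem exists_support {μ : Cardinal.{u}} {A : ZFSet.{u}} (hμ : μ.IsRegular)
    (hlim : ∀ c < μ, Order.succ c < μ) (hA : μ ≤ A.card) {α : Ordinal.{u}} {y : ZFSet.{u}}
    (hy : y ∈ hier μ A α) : ∃ s ∈ smallSubsets μ A, y ∈ hierTop s.card s := by
  induction α using WellFoundedLT.induction generalizing y with
  | _ α ih =>
    rcases mem_hier_iff.1 hy with h | ⟨β, hβ, h, hc⟩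
    · refine ⟨{y}, mem_smallSubsets.2 ⟨fun z hz => ?_, ?_⟩, subset_hierTop (by simp)⟩
      · rwa [ZFSet.mem_singleton.1 hz]
      · rw [ZFSet.card_singleton]
        exact_mod_cast hμ.nat_lt 1
    · choose s hs hsy using fun z : y => ih β hβ (h z.2)
      have hU : (ZFSet.iUnion s).card < μ :=
        card_iUnion_lt hμ (mk_coe_lt.2 hc) fun z => (mem_smallSubsets.1 (hs z)).2
      -- The union of the supports may be too small to bound the size of `y` or to leave room for
      -- one more level; padding by `t` cures both.
      have hc' : Order.succ (max (ZFSet.iUnion s).card y.card) < μ := hlim _ (max_lt hU hc)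
      obtain ⟨t, htA, ht⟩ := exists_subset_card_eq (hc'.le.trans hA)
      have hlt : max (ZFSet.iUnion s).card y.card < (ZFSet.iUnion s ∪ t).card := by
        refine (Order.lt_succ _).trans_le (ht ▸ ZFSet.card_mono fun z hz => ?_)
        exact ZFSet.mem_union.2 (.inr hz)
      refine ⟨ZFSet.iUnion s ∪ t, mem_smallSubsets.2 ⟨fun z hz => ?_,
        card_union_lt hμ.aleph0_le hU (ht ▸ hc')⟩, ?_⟩
      · rcases ZFSet.mem_union.1 hz with hz | hz
        · obtain ⟨i, hi⟩ := ZFSet.mem_iUnion.1 hz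
          exact (mem_smallSubsets.1 (hs i)).1 hi
        · exact htA hz
      · refine mem_hier_iff.2 (.inr ⟨(ZFSet.iUnion s).card.ord,
          Cardinal.ord_lt_ord.2 ((le_max_left _ _).trans_lt hlt), fun z hz => ?_,
          (le_max_right _ _).trans_lt hlt⟩)
        have h1 : s ⟨z, hz⟩ ⊆ ZFSet.iUnion s := ZFSet.subset_iUnion s ⟨z, hz⟩
        have h2 : (s ⟨z, hz⟩).card ≤ (ZFSet.iUnion s).card := ZFSet.card_mono h1
        exact hier_mono (h2.trans ((le_max_left _ _).trans hlt.le))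
          (fun w hw => ZFSet.mem_union.2 (.inl (h1 hw))) (Cardinal.ord_le_ord.2 h2)
          (hsy ⟨z, hz⟩)

/-! ### Closure points of `reflectBase` -/

theorem exists_cofinal_subset (o : Ordinal.{u}) :
    ∃ y ⊆ o.toZFSet, y.card ≤ o.cof ∧ ∀ a < o, ∃ b, a ≤ b ∧ b.toZFSet ∈ y := by
  obtain ⟨S, hS, hSc⟩ := Order.exists_cof_eq (Set.Iio o)
  refine ⟨ZFSet.range fun i : S => i.1.1.toZFSet, fun z hz => ?_, ?_, fun a ha => ?_⟩
  · obtain ⟨i, rfl⟩ := ZFSet.mem_range.1 hz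
    exact toZFSet_mem_toZFSet_iff.2 i.1.2
  · have := ZFSet.lift_card_range_le (f := fun i : S => i.1.1.toZFSet)
    rw [hSc, Ordinal.cof_Iio, ← Ordinal.lift_cof] at this
    simpa [-Ordinal.lift_cof] using this
  · obtain ⟨b, hb, hab⟩ := hS ⟨a, ha⟩
    exact ⟨b.1, hab, ZFSet.mem_range.2 ⟨⟨b, hb⟩, rfl⟩⟩

theorem card_lt_of_mem_ord {κ : Cardinal.{u}} {z : ZFSet.{u}} (hz : z ∈ κ.ord.toZFSet) :
    z.card < κ := by
  obtain ⟨a, ha, rfl⟩ := mem_toZFSet_iff.1 hz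
  rw [card_toZFSet]
  exact Cardinal.lt_ord.1 ha

/-- A function on `P_κ lam` whose closure points `x` satisfy that `x ∩ κ` is a regular limit
cardinal. -/
noncomputable def reflectBase (κ : Cardinal.{u}) (y : ZFSet.{u}) : ZFSet.{u} :=
  (y ∩ κ.ord.toZFSet) ∪ ZFSet.sUnion (y ∩ κ.ord.toZFSet) ∪ (Order.succ y.card).ord.toZFSet

theorem mapsPk_reflectBase {κ lam : Cardinal.{u}} (hκ : κ.IsInaccessible) (hle : κ ≤ lam) :
    MapsPk κ lam (reflectBase κ) := by
  intro y hy
  obtain ⟨hyl, hyc⟩ := mem_smallSubsets.1 hy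
  have hκl : κ.ord.toZFSet ⊆ lam.ord.toZFSet :=
    toZFSet_subset_toZFSet_iff.2 (Cardinal.ord_le_ord.2 hle)
  have hsucc : Order.succ y.card < κ := hκ.isSuccLimit.succ_lt hyc
  have hint : (y ∩ κ.ord.toZFSet).card < κ :=
    (ZFSet.card_mono fun z hz => (ZFSet.mem_inter.1 hz).1).trans_lt hyc
  refine mem_smallSubsets.2 ⟨fun z hz => hκl ?_, ?_⟩
  · rcases ZFSet.mem_union.1 hz with hz | hz
    · rcases ZFSet.mem_union.1 hz with hz | hz
      · exact (ZFSet.mem_inter.1 hz).2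
      · obtain ⟨a, ha, hza⟩ := ZFSet.mem_sUnion.1 hz
        exact (ZFSet.isOrdinal_toZFSet _).mem_trans hza (ZFSet.mem_inter.1 ha).2
    · exact toZFSet_subset_toZFSet_iff.2 (Cardinal.ord_le_ord.2 hsucc.le) hz
  · refine card_union_lt hκ.aleph0_lt.le (card_union_lt hκ.aleph0_lt.le hint
      (card_sUnion_lt hκ.isRegular hint fun z hz =>
        card_lt_of_mem_ord (ZFSet.mem_inter.1 hz).2)) ?_
    rwa [card_toZFSet, Cardinal.card_ord]

/-- If `P_{κ_x} x` is closed under `reflectBase κ`, then `x ∩ κ = κ_x` is a weakly inaccessible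
cardinal or `ω`. -/
theorem reflectBase_closed {κ : Cardinal.{u}} {x : ZFSet.{u}} (hx : x ∩ κ.ord.toZFSet ≠ ∅)
    (h : ∀ y ∈ smallSubsets (kap κ x) x, reflectBase κ y ∈ smallSubsets (kap κ x) x) :
    x ∩ κ.ord.toZFSet = (kap κ x).ord.toZFSet ∧ (kap κ x).IsRegular ∧
      ∀ c < kap κ x, Order.succ c < kap κ x := by
  have hlim : ∀ c < kap κ x, Order.succ c < kap κ x := by
    intro c hc
    obtain ⟨t, ht, rfl⟩ := exists_subset_card_eq hc.le
    have := h t (mem_smallSubsets.2 ⟨fun z hz => (ZFSet.mem_inter.1 (ht hz)).1, hc⟩)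
    refine lt_of_le_of_lt ?_ (mem_smallSubsets.1 this).2
    rw [← Cardinal.card_ord (Order.succ t.card), ← card_toZFSet]
    exact ZFSet.card_mono fun z hz => ZFSet.mem_union.2 (.inr hz)
  have hpos : 0 < kap κ x := by
    obtain ⟨a, ha⟩ := (ZFSet.eq_empty_or_nonempty _).resolve_left hx
    have : ({a} : ZFSet.{u}).card ≤ kap κ x := ZFSet.card_mono fun z hz => by
      rwa [ZFSet.mem_singleton.1 hz]
    rw [ZFSet.card_singleton] at this
    exact zero_lt_one.trans_le this
  have hnat : ∀ n : ℕ, (n : Cardinal.{u}) < kap κ x := by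
    intro n
    induction n with
    | zero => simpa using hpos
    | succ n ih => simpa using hlim _ ih
  -- Closure at singletons: `⋃ {a} = a` is part of the value, so x ∩ κ is transitive with members of
  -- size below κ_x.
  have hsing : ∀ a ∈ x ∩ κ.ord.toZFSet, a ⊆ x ∧ a.card < kap κ x := by
    intro a ha
    have hb := mem_smallSubsets.1 (h {a} (mem_smallSubsets.2 ⟨fun z hz => by
      rw [ZFSet.mem_singleton.1 hz]; exact (ZFSet.mem_inter.1 ha).1, by
      rw [ZFSet.card_singleton]; exact_mod_cast hnat 1⟩))
    have hsub : a ⊆ reflectBase κ {a} := fun z hz =>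
      ZFSet.mem_union.2 (.inl (ZFSet.mem_union.2 (.inr (ZFSet.mem_sUnion.2
        ⟨a, ZFSet.mem_inter.2 ⟨ZFSet.mem_singleton.2 rfl, (ZFSet.mem_inter.1 ha).2⟩, hz⟩))))
    exact ⟨fun z hz => hb.1 (hsub hz), (ZFSet.card_mono hsub).trans_lt hb.2⟩
  have hord : (x ∩ κ.ord.toZFSet).IsOrdinal := by
    refine ZFSet.isOrdinal_iff_forall_mem_isOrdinal.2 ⟨fun a ha z hz => ?_, fun a ha =>
      (ZFSet.isOrdinal_toZFSet _).mem (ZFSet.mem_inter.1 ha).2⟩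
    exact ZFSet.mem_inter.2 ⟨(hsing a ha).1 hz,
      (ZFSet.isOrdinal_toZFSet _).mem_trans hz (ZFSet.mem_inter.1 ha).2⟩
  have heq : x ∩ κ.ord.toZFSet = (kap κ x).ord.toZFSet := by
    obtain ⟨δ, hδ⟩ := ZFSet.isOrdinal_iff_mem_range_toZFSet.1 hord
    have hcard : δ.card = kap κ x := by rw [kap, ← hδ, card_toZFSet]
    have hle : (kap κ x).ord ≤ δ := by rw [← hcard]; exact Cardinal.ord_card_le δ
    rcases hle.eq_or_lt with h' | h'
    · rw [h', hδ]
    -- Otherwise κ_x itself would be a member of x ∩ κ, yet members have size below κ_x.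
    · have := (hsing (kap κ x).ord.toZFSet (hδ ▸ toZFSet_mem_toZFSet_iff.2 h')).2
      simp at this
  refine ⟨heq, ⟨Cardinal.aleph0_le.2 fun n => (hnat n).le, ?_⟩, hlim⟩
  -- A cofinal `y` of size below κ_x would have a value covering all of x ∩ κ.
  by_contra! hcof
  obtain ⟨y, hy, hyc, hcofinal⟩ := exists_cofinal_subset (kap κ x).ord
  rw [← heq] at hy
  have hb := mem_smallSubsets.1 (h y (mem_smallSubsets.2
    ⟨fun z hz => (ZFSet.mem_inter.1 (hy hz)).1, hyc.trans_lt hcof⟩))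
  refine hb.2.not_ge (ZFSet.card_mono fun a ha => ?_)
  rw [heq] at ha
  obtain ⟨α, hα, rfl⟩ := mem_toZFSet_iff.1 ha
  obtain ⟨b, hab, hb⟩ := hcofinal α hα
  have hb' : b.toZFSet ∈ y ∩ κ.ord.toZFSet :=
    ZFSet.mem_inter.2 ⟨hb, (ZFSet.mem_inter.1 (hy hb)).2⟩
  rcases hab.eq_or_lt with rfl | hab
  · exact ZFSet.mem_union.2 (.inl (ZFSet.mem_union.2 (.inl hb')))
  · exact ZFSet.mem_union.2 (.inl (ZFSet.mem_union.2 (.inr (ZFSet.mem_sUnion.2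
      ⟨_, hb', toZFSet_mem_toZFSet_iff.2 hab⟩))))

/-! ### Strong stationarity implies indescribability -/

/-- The Tarski–Vaught criterion for `(M, ∈, R ∩ M) ≼ (N, ∈, R)`. -/
theorem models_inter_iff {M N R : ZFSet.{u}} (hMN : M ⊆ N)
    (htv : ∀ (n : ℕ) (φ : setPredLang.BoundedFormula Empty (n + 1)) (x : Fin n → N),
      (∀ i, (x i).1 ∈ M) → letI := setPredStructure N R
      (∃ a : N, φ.Realize default (Fin.snoc x a : Fin (n + 1) → N)) →
        ∃ b : N, b.1 ∈ M ∧ φ.Realize default (Fin.snoc x b : Fin (n + 1) → N))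
    (φ : setPredLang.Sentence) : Models M (R ∩ M) φ ↔ Models N R φ := by
  let := setPredStructure N R
  let := setPredStructure M (R ∩ M)
  let f : M ↪[setPredLang] N :=
    { toFun := fun a => ⟨a.1, hMN a.2⟩
      inj' := fun a b h => Subtype.ext (congrArg (fun c : N => c.1) h)
      map_fun' := fun g => g.elim
      map_rel' := by
        rintro n (_ | _) v
        · exact Iff.rfl
        · exact ⟨fun h => ZFSet.mem_inter.2 ⟨h, (v 0).2⟩, fun h => (ZFSet.mem_inter.1 h).1⟩ }
  refine (f.toElementaryEmbedding fun n ψ x a ha => ?_).map_sentence φ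
  obtain ⟨b, hb, hr⟩ := htv n ψ (f ∘ x) (fun i => (x i).2) ⟨a, ha⟩
  exact ⟨⟨b.1, hb⟩, hr⟩

theorem mk_boundedFormula_le :
    #(Σ n, setPredLang.BoundedFormula Empty n) ≤ ℵ₀ := by
  refine Language.BoundedFormula.card_le.trans ?_
  have h : setPredLang.card ≤ ℵ₀ := by
    have : Countable (Σ l, setPredLang.Functions l) :=
      ⟨⟨fun f => Empty.elim f.2, fun f => Empty.elim f.2⟩⟩
    have : ∀ l, Countable (setPredLang.Relations l) := fun l => by
      refine ⟨⟨fun _ => 0, ?_⟩⟩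
      rintro (_ | _) (_ | _) _ <;> rfl
    exact Cardinal.mk_le_aleph0_iff.2 (inferInstanceAs (Countable (_ ⊕ _)))
  simpa using h

/-- Formulas are countably many and tuples embed into lists; this keeps the values of the Skolem
function of size below κ. -/
theorem mk_tuples_lt {κ : Cardinal.{u}} (hκ : ℵ₀ < κ) {T : Type (u + 1)}
    (hT : #T < Cardinal.lift.{u + 1} κ) :
    #(Σ n, setPredLang.BoundedFormula Empty (n + 1) × (Fin n → T)) < Cardinal.lift.{u + 1} κ := by
  have hκ' : ℵ₀ < Cardinal.lift.{u + 1} κ := by simpa using hκ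
  have hinj : Function.Injective
      (fun p : Σ n, setPredLang.BoundedFormula Empty (n + 1) × (Fin n → T) =>
        ((⟨p.1 + 1, p.2.1⟩, List.ofFn p.2.2) :
          (Σ n, setPredLang.BoundedFormula Empty n) × List T)) := by
    rintro ⟨n, φ, x⟩ ⟨m, ψ, y⟩ h
    simp only [Prod.mk.injEq, Sigma.mk.injEq, Nat.add_right_cancel_iff] at h
    obtain ⟨⟨rfl, h1⟩, h2⟩ := h
    rw [eq_of_heq h1, List.ofFn_injective h2]
  refine (Cardinal.mk_le_of_injective hinj).trans_lt ?_
  rw [Cardinal.mk_prod]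
  refine Cardinal.mul_lt_of_lt hκ'.le ?_ ?_
  · refine lt_of_le_of_lt ?_ hκ'
    simpa [-Cardinal.mk_sigma] using mk_boundedFormula_le
  · simpa using (Cardinal.mk_list_le_max T).trans_lt (max_lt hκ' hT)

theorem firstOrderIndescribable_of_stronglyStationary {κ lam : Cardinal.{u}}
    (hκ : κ.IsInaccessible) (hle : κ ≤ lam) {S : ZFSet.{u}}
    (hS : StronglyStationary κ lam S) : FirstOrderIndescribable κ lam S := by
  intro R _ φ hφ
  let := setPredStructure (hierTop κ lam.ord.toZFSet) R
  have hsupp : ∀ y ∈ hierTop κ lam.ord.toZFSet, ∃ s ∈ Pk κ lam, y ∈ hierTop s.card s :=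
    fun y hy => exists_support hκ.isRegular (fun c hc => hκ.isSuccLimit.succ_lt hc)
      (by simpa using hle) hy
  have hwit : ∀ (n : ℕ) (ψ : setPredLang.BoundedFormula Empty (n + 1))
      (x : Fin n → hierTop κ lam.ord.toZFSet), ∃ s ∈ Pk κ lam,
      (∃ a : hierTop κ lam.ord.toZFSet, ψ.Realize default (Fin.snoc x a : Fin (n + 1) → _)) →
        ∃ b : hierTop κ lam.ord.toZFSet, b.1 ∈ hierTop s.card s ∧
          ψ.Realize default (Fin.snoc x b : Fin (n + 1) → _) := by
    intro n ψ x
    by_cases h : ∃ a : hierTop κ lam.ord.toZFSet,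
        ψ.Realize default (Fin.snoc x a : Fin (n + 1) → _)
    · obtain ⟨a, ha⟩ := h
      obtain ⟨s, hs, has⟩ := hsupp a.1 a.2
      exact ⟨s, hs, fun _ => ⟨a, has, ha⟩⟩
    -- Default support when there is no witness.
    · exact ⟨∅, mem_smallSubsets.2 ⟨ZFSet.empty_subset _, by simpa using hκ.pos⟩,
        fun h' => (h h').elim⟩
  choose wit hwitPk hwit using hwit
  let T : ZFSet.{u} → Type (u + 1) := fun y =>
    {a : hierTop κ lam.ord.toZFSet // a.1 ∈ hierTop y.card y}
  have hT : ∀ y ∈ Pk κ lam, #(T y) < Cardinal.lift.{u + 1} κ := by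
    intro y hy
    have hy' := (mem_smallSubsets.1 hy).2
    refine lt_of_le_of_lt (Cardinal.mk_le_of_injective (f := fun a : T y =>
      (⟨a.1.1, a.2⟩ : hierTop y.card y)) fun a b h => ?_)
      (mk_coe_lt.2 (card_hier_lt hκ hy' (Cardinal.ord_lt_ord.2 hy')))
    exact Subtype.ext (Subtype.ext (congrArg (fun c : hierTop y.card y => c.1) h))
  let sk : (y : ZFSet.{u}) →
      (Σ n, setPredLang.BoundedFormula Empty (n + 1) × (Fin n → T y)) → ZFSet.{u} :=
    fun _ p => wit p.1 p.2.1 fun i => (p.2.2 i).1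
  have hmaps : MapsPk κ lam fun y => reflectBase κ y ∪ ZFSet.iUnion (sk y) := by
    intro y hy
    have hb := mem_smallSubsets.1 (mapsPk_reflectBase hκ hle y hy)
    refine mem_smallSubsets.2 ⟨fun z hz => ?_, card_union_lt hκ.aleph0_lt.le hb.2
      (card_iUnion_lt hκ.isRegular (mk_tuples_lt hκ.aleph0_lt (hT y hy)) fun p =>
        (mem_smallSubsets.1 (hwitPk _ _ _)).2)⟩
    rcases ZFSet.mem_union.1 hz with hz | hz
    · exact hb.1 hz
    · obtain ⟨p, hp⟩ := ZFSet.mem_iUnion.1 hz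
      exact (mem_smallSubsets.1 (hwitPk _ _ _)).1 hp
  obtain ⟨x, hx⟩ := (ZFSet.eq_empty_or_nonempty _).resolve_left (hS _ hmaps)
  obtain ⟨hxC, hxS⟩ := ZFSet.mem_inter.1 hx
  obtain ⟨hxPk, hx0, hcl⟩ := ZFSet.mem_sep.1 hxC
  obtain ⟨hxl, hxc⟩ := mem_smallSubsets.1 hxPk
  have hcl' : ∀ y ∈ smallSubsets (kap κ x) x,
      reflectBase κ y ∈ smallSubsets (kap κ x) x ∧
        ∀ p, sk y p ∈ smallSubsets (kap κ x) x := by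
    intro y hy
    obtain ⟨h1, h2⟩ := mem_smallSubsets.1 (hcl y hy)
    have hsub : ∀ z, z ⊆ reflectBase κ y ∪ ZFSet.iUnion (sk y) →
        z ∈ smallSubsets (kap κ x) x := fun z hz =>
      mem_smallSubsets.2 ⟨fun w hw => h1 (hz hw), (ZFSet.card_mono hz).trans_lt h2⟩
    exact ⟨hsub _ fun w hw => ZFSet.mem_union.2 (.inl hw), fun p => hsub _ fun w hw =>
      ZFSet.mem_union.2 (.inr (ZFSet.mem_iUnion.2 ⟨p, hw⟩))⟩
  obtain ⟨hxκ, hreg, hlim⟩ := reflectBase_closed hx0 fun y hy => (hcl' y hy).1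
  have hkx : kap κ x ≤ x.card := ZFSet.card_mono fun z hz => (ZFSet.mem_inter.1 hz).1
  have hkκ : kap κ x ≤ κ := hkx.trans hxc.le
  refine ⟨x, hxS, hxκ, (models_inter_iff (hierTop_mono hkκ hxl) ?_ φ).2 hφ⟩
  intro n ψ a ha hψ
  -- Finitely many parameters share the support `t`, so closure at `t` supplies the support of a
  -- witness inside x.
  choose s hs has using fun i => exists_support hreg hlim hkx (ha i)
  let t : ZFSet.{u} := ZFSet.iUnion fun i : ULift.{u + 1} (Fin n) => s i.down
  have ht : t ∈ smallSubsets (kap κ x) x := by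
    refine mem_smallSubsets.2 ⟨fun z hz => ?_, card_iUnion_lt hreg ?_ fun i =>
      (mem_smallSubsets.1 (hs i.down)).2⟩
    · obtain ⟨i, hi⟩ := ZFSet.mem_iUnion.1 hz
      exact (mem_smallSubsets.1 (hs i.down)).1 hi
    · simpa using hreg.nat_lt n
  have hat : ∀ i, (a i).1 ∈ hierTop t.card t := fun i => by
    have : s i ⊆ t := ZFSet.subset_iUnion (fun i : ULift.{u + 1} (Fin n) => s i.down) ⟨i⟩
    exact hierTop_mono (ZFSet.card_mono this) this (has i)
  obtain ⟨b, hb, hbψ⟩ := hwit n ψ a hψ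
  have hw : wit n ψ a ∈ smallSubsets (kap κ x) x :=
    (hcl' t ht).2 ⟨n, ψ, fun i => ⟨a i, hat i⟩⟩
  obtain ⟨hw1, hw2⟩ := mem_smallSubsets.1 hw
  exact ⟨b, hierTop_mono hw2.le hw1 hb, hbψ⟩

/-! ### Indescribability implies strong stationarity -/

/-- `∃ y, y = y`, and for every `y` there is an element of the predicate all of whose elements
contain `y`. -/
def pairSentence : setPredLang.Sentence :=
  (Language.BoundedFormula.all (Language.BoundedFormula.ex
    (Language.Relations.boundedFormula₁ (L := setPredLang) (n := 2) SetPredRel.pred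
      (Language.Term.var (Sum.inr 1)) ⊓
    Language.BoundedFormula.all
      ((Language.Relations.boundedFormula₂ (L := setPredLang) (n := 3) SetPredRel.mem
        (Language.Term.var (Sum.inr 2)) (Language.Term.var (Sum.inr 1))).imp
      (Language.Relations.boundedFormula₂ (L := setPredLang) (n := 3) SetPredRel.mem
        (Language.Term.var (Sum.inr 0)) (Language.Term.var (Sum.inr 2))))))) ⊓
  Language.BoundedFormula.ex ⊤

theorem models_pairSentence {M R : ZFSet.{u}} : Models M R pairSentence ↔
    (∀ y ∈ M, ∃ p ∈ M, p ∈ R ∧ ∀ a ∈ M, a ∈ p → y ∈ a) ∧ M.Nonempty := by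
  let := setPredStructure M R
  unfold Models pairSentence Language.Sentence.Realize Language.Formula.Realize
  simp only [Language.BoundedFormula.realize_inf, Language.BoundedFormula.realize_all,
    Language.BoundedFormula.realize_ex, Language.BoundedFormula.realize_imp,
    Language.BoundedFormula.realize_top]
  change ((∀ y : M, ∃ p : M, p.1 ∈ R ∧ ∀ a : M, a.1 ∈ p.1 → y.1 ∈ a.1) ∧ ∃ _ : M, True) ↔ _
  simp [ZFSet.nonempty_def, and_left_comm]

theorem insert_singleton_mem_hierTop {μ : Cardinal.{u}} (hμ : ℵ₀ ≤ μ) {A a b : ZFSet.{u}}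
    (ha : a ∈ hierTop μ A) (hb : b ∈ hierTop μ A) : ({a, b} : ZFSet.{u}) ∈ hierTop μ A := by
  have hlim := Cardinal.isSuccLimit_ord hμ
  rw [hierTop, hier_limit μ A hlim, ZFSet.mem_iUnion] at ha hb
  obtain ⟨⟨α, hα⟩, ha⟩ := ha
  obtain ⟨⟨β, hβ⟩, hb⟩ := hb
  refine mem_hier_iff.2 (.inr ⟨max α β, max_lt hα hβ, fun z hz => ?_, ?_⟩)
  · rcases ZFSet.mem_pair.1 hz with rfl | rfl
    · exact hier_mono le_rfl (fun _ h => h) (le_max_left α β) ha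
    · exact hier_mono le_rfl (fun _ h => h) (le_max_right α β) hb
  · refine ZFSet.card_insert_le.trans_lt ?_
    rw [ZFSet.card_singleton]
    exact lt_of_lt_of_le (by exact_mod_cast Cardinal.natCast_lt_aleph0 (n := 2)) hμ

theorem pair_mem_hierTop {μ : Cardinal.{u}} (hμ : ℵ₀ ≤ μ) {A a b : ZFSet.{u}}
    (ha : a ∈ hierTop μ A) (hb : b ∈ hierTop μ A) : ZFSet.pair a b ∈ hierTop μ A := by
  have := insert_singleton_mem_hierTop hμ ha ha
  rw [ZFSet.pair_eq_singleton] at this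
  exact insert_singleton_mem_hierTop hμ this (insert_singleton_mem_hierTop hμ ha hb)

/-- A nonempty ordinal contains ∅, but both members of a Kuratowski pair are inhabited. Hence no
pair is an element of the ground set x. -/
theorem not_isOrdinal_pair {a b : ZFSet.{u}} : ¬ (ZFSet.pair a b).IsOrdinal := by
  intro h
  have h0 : ∅ ∈ ZFSet.pair a b := by
    refine (ZFSet.isOrdinal_empty.mem_or_subset h).resolve_right fun h' => ?_
    exact ZFSet.notMem_empty {a} (h' (ZFSet.mem_pair.2 (.inl rfl)))
  rcases ZFSet.mem_pair.1 h0 with h' | h'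
  · exact ZFSet.notMem_empty a (h' ▸ ZFSet.mem_singleton.2 rfl)
  · exact ZFSet.notMem_empty a (h' ▸ ZFSet.mem_pair.2 (.inl rfl))

theorem mem_ord_of_card_lt {κ : Cardinal.{u}} {z : ZFSet.{u}} (hz : z.IsOrdinal)
    (hc : z.card < κ) : z ∈ κ.ord.toZFSet := by
  obtain ⟨a, rfl⟩ := ZFSet.isOrdinal_iff_mem_range_toZFSet.1 hz
  rw [card_toZFSet] at hc
  exact toZFSet_mem_toZFSet_iff.2 (Cardinal.lt_ord.2 hc)

theorem isOrdinal_of_mem_toZFSet {o : Ordinal.{u}} {z : ZFSet.{u}} (hz : z ∈ o.toZFSet) :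
    z.IsOrdinal :=
  (ZFSet.isOrdinal_toZFSet o).mem hz

/-- If `x ∩ κ = κ_x`, then the ordinals of `V_{κ_x}(κ_x, x)` are the elements of `x`. -/
theorem mem_of_mem_hier_of_isOrdinal {κ : Cardinal.{u}} {x z : ZFSet.{u}} {α : Ordinal.{u}}
    (hx : x ∩ κ.ord.toZFSet = (kap κ x).ord.toZFSet) (hz : z ∈ hier (kap κ x) x α)
    (ho : z.IsOrdinal) : z ∈ x := by
  rcases mem_hier_iff.1 hz with h | ⟨_, _, _, h⟩
  · exact h
  · have := mem_ord_of_card_lt ho h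
    rw [← hx] at this
    exact (ZFSet.mem_inter.1 this).1

/-- If `v` lies in x, it is an ordinal below κ, hence below κ_x, and so a subset of x. If it enters
later, its elements are ordinals of the hierarchy, which lie in x. -/
theorem mem_smallSubsets_of_mem_hier {κ lam : Cardinal.{u}} {x v : ZFSet.{u}} {α : Ordinal.{u}}
    (hx : x ∩ κ.ord.toZFSet = (kap κ x).ord.toZFSet) (hxl : x ⊆ lam.ord.toZFSet)
    (hv : v ∈ Pk κ lam) (hvx : v ∈ hier (kap κ x) x α) : v ∈ smallSubsets (kap κ x) x := by
  obtain ⟨hvl, hvc⟩ := mem_smallSubsets.1 hv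
  rcases mem_hier_iff.1 hvx with h | ⟨β, hβ, hsub, hc⟩
  · have hvκ : v ∈ (kap κ x).ord.toZFSet :=
      hx ▸ ZFSet.mem_inter.2 ⟨h, mem_ord_of_card_lt (isOrdinal_of_mem_toZFSet (hxl h)) hvc⟩
    refine mem_smallSubsets.2 ⟨fun z hz => ?_, card_lt_of_mem_ord hvκ⟩
    have := (ZFSet.isOrdinal_toZFSet _).mem_trans hz hvκ
    rw [← hx] at this
    exact (ZFSet.mem_inter.1 this).1
  · exact mem_smallSubsets.2 ⟨fun z hz => mem_of_mem_hier_of_isOrdinal hx (hsub hz)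
      (isOrdinal_of_mem_toZFSet (hvl hz)), hc⟩

theorem stronglyStationary_of_firstOrderIndescribable {κ lam : Cardinal.{u}}
    (hκ : κ.IsInaccessible) {S : ZFSet.{u}} (hS : S ⊆ Pk κ lam)
    (h : FirstOrderIndescribable κ lam S) : StronglyStationary κ lam S := by
  classical
  intro f hf
  -- Extending by the identity lets the sentence quantify over the whole structure without defining
  -- P_κ lam in it.
  let F : ZFSet.{u} → ZFSet.{u} := fun u => if u ∈ Pk κ lam then f u else u
  have hPkM : ∀ {μ : Cardinal.{u}} {A y : ZFSet.{u}}, 0 < μ → y ∈ smallSubsets μ A →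
      y ∈ hierTop μ A := by
    intro μ A y hμ hy
    obtain ⟨h1, h2⟩ := mem_smallSubsets.1 hy
    exact mem_hier_iff.2 (.inr ⟨0, Cardinal.ord_pos.2 hμ, by rwa [hier_zero], h2⟩)
  have hFM : ∀ u ∈ hierTop κ lam.ord.toZFSet, F u ∈ hierTop κ lam.ord.toZFSet := by
    intro u hu
    by_cases hu' : u ∈ Pk κ lam
    · simpa [F, hu'] using hPkM hκ.pos (hf u hu')
    · simpa [F, hu'] using hu
  let R : ZFSet.{u} := (hierTop κ lam.ord.toZFSet).sep fun p => ∃ u, p = ZFSet.pair u (F u)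
  have hmod : Models (hierTop κ lam.ord.toZFSet) R pairSentence := by
    refine models_pairSentence.2 ⟨fun y hy => ?_, ∅, hPkM hκ.pos
      (mem_smallSubsets.2 ⟨ZFSet.empty_subset _, by simpa using hκ.pos⟩)⟩
    have hp := pair_mem_hierTop hκ.aleph0_lt.le hy (hFM y hy)
    refine ⟨_, hp, ZFSet.mem_sep.2 ⟨hp, y, rfl⟩, fun a _ ha => ?_⟩
    rcases ZFSet.mem_pair.1 ha with rfl | rfl
    · exact ZFSet.mem_singleton.2 rfl
    · exact ZFSet.mem_pair.2 (.inl rfl)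
  obtain ⟨x, hxS, hxκ, hxmod⟩ := h R ZFSet.sep_subset _ hmod
  obtain ⟨hx1, y₀, hy₀⟩ := models_pairSentence.1 hxmod
  have hxPk := hS hxS
  obtain ⟨hxl, -⟩ := mem_smallSubsets.1 hxPk
  have hcode : ∀ y ∈ hierTop (kap κ x) x, ∃ p u, p = ZFSet.pair u (F u) ∧
      (∀ a ∈ hierTop (kap κ x) x, a ∈ p → y ∈ a) ∧
      ∃ β < (kap κ x).ord, p ⊆ hier (kap κ x) x β := by
    intro y hy
    obtain ⟨p, hp, hpR, hpy⟩ := hx1 y hy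
    obtain ⟨-, u, rfl⟩ := ZFSet.mem_sep.1 (ZFSet.mem_inter.1 hpR).1
    refine ⟨_, u, rfl, hpy, ?_⟩
    rcases mem_hier_iff.1 hp with hp | ⟨β, hβ, hp, -⟩
    · exact (not_isOrdinal_pair (isOrdinal_of_mem_toZFSet (hxl hp))).elim
    · exact ⟨β, hβ, hp⟩
  -- The nonemptiness conjunct provides a pair, which must appear at a positive level.
  have hpos : 0 < (kap κ x).ord := by
    obtain ⟨_, _, _, _, β, hβ, _⟩ := hcode y₀ hy₀
    exact hβ.bot_lt
  have hx0 : x ∩ κ.ord.toZFSet ≠ ∅ := by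
    intro h0
    have : toZFSet 0 ∈ (kap κ x).ord.toZFSet := toZFSet_mem_toZFSet_iff.2 hpos
    rw [← hxκ, h0] at this
    exact ZFSet.notMem_empty _ this
  have hsub : ∀ {β}, β < (kap κ x).ord → hier (kap κ x) x β ⊆ hierTop (kap κ x) x :=
    fun hβ => hier_mono le_rfl (fun _ h => h) hβ.le
  suffices hfx : ∀ y ∈ smallSubsets (kap κ x) x, f y ∈ smallSubsets (kap κ x) x by
    intro he
    have : x ∈ weakClub κ lam f ∩ S :=
      ZFSet.mem_inter.2 ⟨ZFSet.mem_sep.2 ⟨hxPk, hx0, hfx⟩, hxS⟩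
    rw [he] at this
    exact ZFSet.notMem_empty _ this
  intro y hy
  have hkκ : kap κ x ≤ κ := by
    have : (kap κ x).ord.toZFSet ⊆ κ.ord.toZFSet := hxκ ▸ fun z hz => (ZFSet.mem_inter.1 hz).2
    exact Cardinal.ord_le_ord.1 (toZFSet_subset_toZFSet_iff.1 this)
  have hyPk : y ∈ Pk κ lam := smallSubsets_mono hkκ hxl hy
  obtain ⟨p, u, rfl, hpy, β, hβ, hp⟩ := hcode y (hPkM (Cardinal.ord_pos.1 hpos) hy)
  have hu : {u} ∈ ZFSet.pair u (F u) := ZFSet.mem_pair.2 (.inl rfl)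
  have huv : {u, F u} ∈ ZFSet.pair u (F u) := ZFSet.mem_pair.2 (.inr rfl)
  -- Since `{u}` belongs to the structure and to the pair, `pairSentence` forces `y ∈ {u}`.
  obtain rfl : y = u := ZFSet.mem_singleton.1 (hpy _ (hsub hβ (hp hu)) hu)
  have hFy : F y = f y := by simp [F, hyPk]
  rw [hFy] at hp huv
  have hv : f y ∈ ({y, f y} : ZFSet.{u}) := ZFSet.mem_pair.2 (.inr rfl)
  rcases mem_hier_iff.1 (hp huv) with h' | ⟨γ, hγ, hγs, -⟩
  -- The ground set is not transitive in general, but if `{y, f y}` is an ordinal in x, its finite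
  -- size puts it in κ_x, whose elements lie in x.
  · have hc : ({y, f y} : ZFSet.{u}).card < κ := by
      refine ZFSet.card_insert_le.trans_lt ?_
      rw [ZFSet.card_singleton]
      exact lt_of_lt_of_le (by exact_mod_cast Cardinal.natCast_lt_aleph0 (n := 2))
        hκ.aleph0_lt.le
    have hm : ({y, f y} : ZFSet.{u}) ∈ (kap κ x).ord.toZFSet :=
      hxκ ▸ ZFSet.mem_inter.2
        ⟨h', mem_ord_of_card_lt (isOrdinal_of_mem_toZFSet (hxl h')) hc⟩
    have hm' := (ZFSet.isOrdinal_toZFSet _).mem_trans hv hm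
    rw [← hxκ] at hm'
    exact mem_smallSubsets_of_mem_hier hxκ hxl (hf y hyPk)
      (subset_hierTop (ZFSet.mem_inter.1 hm').1)
  · exact mem_smallSubsets_of_mem_hier hxκ hxl (hf y hyPk) (hγs hv)

/-! ### Separating the two ideals -/

theorem exists_mem_isJechClub_notMem_weakClub {κ lam : Cardinal.{u}} (hκ : κ.IsInaccessible)
    (hle : κ ≤ lam) {C : ZFSet.{u}} (hC : IsJechClub κ lam C) :
    ∃ x ∈ C, x ∉ weakClub κ lam (reflectBase κ) := by
  have hord : ∀ c < κ, c.ord.toZFSet ∈ Pk κ lam := fun c hc =>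
    mem_smallSubsets.2 ⟨toZFSet_subset_toZFSet_iff.2 (Cardinal.ord_le_ord.2 (hc.le.trans hle)),
      by simpa using hc⟩
  have hstep : ∀ x : C, ∃ y : C, x.1 ⊆ y.1 ∧ (Order.succ x.1.card).ord.toZFSet ⊆ y.1 := by
    intro x
    obtain ⟨hx1, hx2⟩ := mem_smallSubsets.1 (hC.subset x.2)
    obtain ⟨h1, h2⟩ := mem_smallSubsets.1 (hord _ (hκ.isSuccLimit.succ_lt hx2))
    obtain ⟨y, hy, hxy⟩ := hC.unbounded (x.1 ∪ (Order.succ x.1.card).ord.toZFSet)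
      (mem_smallSubsets.2 ⟨fun z hz => (ZFSet.mem_union.1 hz).elim (@hx1 z) (@h1 z),
        card_union_lt hκ.aleph0_lt.le hx2 h2⟩)
    exact ⟨⟨y, hy⟩, fun z hz => hxy (ZFSet.mem_union.2 (.inl hz)),
      fun z hz => hxy (ZFSet.mem_union.2 (.inr hz))⟩
  choose g hg1 hg2 using hstep
  -- Starting above ω makes κ_x uncountable for the union x, so regularity applies to a countable
  -- union.
  obtain ⟨x₀, hx₀C, hx₀⟩ := hC.unbounded _ (hord _ hκ.aleph0_lt)
  let s : ℕ → C := fun n => g^[n] ⟨x₀, hx₀C⟩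
  have hs : ∀ n, s (n + 1) = g (s n) := fun n => Function.iterate_succ_apply' g n _
  have hmono : ∀ {m n}, m ≤ n → (s m).1 ⊆ (s n).1 := by
    intro m n hmn
    induction n, hmn using Nat.le_induction with
    | base => exact fun z hz => hz
    | succ n _ ih => exact fun z hz => hs n ▸ hg1 (s n) (ih hz)
  let D : ZFSet.{u} := ZFSet.range fun n : ℕ => (s n).1
  have hDC : D ⊆ C := fun z hz => by
    obtain ⟨n, rfl⟩ := ZFSet.mem_range.1 hz
    exact (s n).2
  have hDcard : D.card ≤ ℵ₀ := by
    simpa using ZFSet.lift_card_range_le (f := fun n : ℕ => (s n).1)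
  have hDmem : ∀ n, (s n).1 ∈ D := fun n => ZFSet.mem_range.2 ⟨n, rfl⟩
  have hX : ZFSet.sUnion D ∈ C := by
    refine hC.closed D hDC (fun h => ?_) (hDcard.trans_lt hκ.aleph0_lt) fun x hx y hy => ?_
    · exact ZFSet.notMem_empty _ (h ▸ hDmem 0)
    · obtain ⟨m, rfl⟩ := ZFSet.mem_range.1 hx
      obtain ⟨n, rfl⟩ := ZFSet.mem_range.1 hy
      exact (le_total m n).imp hmono hmono
  refine ⟨_, hX, fun hXw => ?_⟩
  obtain ⟨-, hX0, hXcl⟩ := ZFSet.mem_sep.1 hXw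
  obtain ⟨-, hreg, -⟩ := reflectBase_closed hX0 hXcl
  have hcard : ∀ n, (s n).1.card < kap κ (ZFSet.sUnion D) := by
    intro n
    have hn := hκ.isSuccLimit.succ_lt (mem_smallSubsets.1 (hC.subset (s n).2)).2
    refine (Order.lt_succ _).trans_le ?_
    rw [← Cardinal.card_ord (Order.succ (s n).1.card), ← card_toZFSet]
    refine ZFSet.card_mono fun z hz => ZFSet.mem_inter.2
      ⟨ZFSet.mem_sUnion.2 ⟨_, hDmem (n + 1), ?_⟩,
        toZFSet_subset_toZFSet_iff.2 (Cardinal.ord_le_ord.2 hn.le) hz⟩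
    rw [hs n]
    exact hg2 (s n) hz
  have hunc : ℵ₀ < kap κ (ZFSet.sUnion D) := by
    refine lt_of_le_of_lt ?_ (hcard 0)
    have : ℵ₀ ≤ x₀.card := by simpa using ZFSet.card_mono hx₀
    exact this
  have hlt : (ZFSet.sUnion D).card < kap κ (ZFSet.sUnion D) :=
    card_sUnion_lt hreg (hDcard.trans_lt hunc) fun y hy => by
      obtain ⟨n, rfl⟩ := ZFSet.mem_range.1 hy
      exact hcard n
  exact hlt.not_ge (ZFSet.card_mono fun z hz => (ZFSet.mem_inter.1 hz).1)

theorem NSS_ne_NS {κ lam : Cardinal.{u}} (hκ : κ.IsInaccessible) (hle : κ ≤ lam) :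
    NSS κ lam ≠ NS κ lam := by
  intro h
  have hX : Pk κ lam \ weakClub κ lam (reflectBase κ) ∈ NSS κ lam :=
    ⟨fun z hz => (ZFSet.mem_sdiff.1 hz).1, _, mapsPk_reflectBase hκ hle,
      (ZFSet.eq_empty _).2 fun z hz =>
        (ZFSet.mem_sdiff.1 (ZFSet.mem_inter.1 hz).1).2 (ZFSet.mem_inter.1 hz).2⟩
  rw [h] at hX
  obtain ⟨-, C, hC, he⟩ := hX
  obtain ⟨x, hxC, hx⟩ := exists_mem_isJechClub_notMem_weakClub hκ hle hC
  exact (ZFSet.eq_empty _).1 he x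
    (ZFSet.mem_inter.2 ⟨ZFSet.mem_sdiff.2 ⟨hC.subset hxC, hx⟩, hxC⟩)

theorem mem_NSS_iff {κ lam : Cardinal.{u}} {X : ZFSet.{u}} :
    X ∈ NSS κ lam ↔ X ⊆ Pk κ lam ∧ ¬ StronglyStationary κ lam X := by
  have hcomm : ∀ A B : ZFSet.{u}, A ∩ B = B ∩ A := fun A B => by
    ext z
    simp [and_comm]
  simp [NSS, StronglyStationary, hcomm X]

end PKL

theorem mainTheorem2 (κ lam : Cardinal.{u}) (hκ : PKL.IsMahlo κ) (hle : κ ≤ lam) :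
    (∀ S : ZFSet.{u}, S ⊆ PKL.Pk κ lam →
      (PKL.FirstOrderIndescribable κ lam S ↔ PKL.StronglyStationary κ lam S)) ∧
    PKL.Pi10 κ lam = PKL.NSS κ lam ∧
    PKL.NSS κ lam ≠ PKL.NS κ lam := by
  have hiff : ∀ S : ZFSet.{u}, S ⊆ PKL.Pk κ lam →
      (PKL.FirstOrderIndescribable κ lam S ↔ PKL.StronglyStationary κ lam S) := fun S hS =>
    ⟨PKL.stronglyStationary_of_firstOrderIndescribable hκ.1 hS,
      PKL.firstOrderIndescribable_of_stronglyStationary hκ.1 hle⟩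
  refine ⟨hiff, ?_, PKL.NSS_ne_NS hκ.1 hle⟩
  ext X
  rw [PKL.mem_NSS_iff]
  exact and_congr_right fun hX => not_congr (hiff X hX)
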